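/- There is an absolute constant $C>0$ such that the following holds. Let $d\ge 1$ and $L\geq 0$ be integers and let $p\in\mathbb{Z}[x]$ be a polynomial of degree $d$ that is square-free over $\mathbb{Q}$ (i.e. has no multiple complex roots) and all of whose coefficients have absolute value less than $2^L$. For a real interval $[a,b]$, let the coefficient variation of $p$ on $[a,b]$ be the number of sign changes (zeros being ignored) in the sequence of coefficients of the polynomial $(x+1)^d\,p\!\left(\frac{ax+b}{x+1}\right)$. Consider the Descartes' rule of signs bisection algorithm, which starts with the interval $[-2^L,2^L]$ and repeatedly replaces any interval $[a,b]$ on which the coefficient variation of $p$ is at least $2$ by its two halves $[a,\frac{a+b}{2}]$ and $[\frac{a+b}{2},b]$, while intervals with coefficient variation $0$ or $1$ are terminal. Then the algorithm terminates, and the size (number of all nodes, internal nodes and leaves) of its subdivision tree is at most $C\,d\,(L+\ln d)$. In other words, the size of the subdivision tree is $O(d(L+\ln d))$. -/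

import Mathlib

/-- A finite binary tree in which every node is either a leaf or has exactly two children. -/
inductive BisectionTree : Type
  | leaf : BisectionTree
  | node (left right : BisectionTree) : BisectionTree

namespace BisectionTree

/-- The size of a tree: the number of all its nodes, leaves and internal nodes alike. -/
def size : BisectionTree → ℕ
  | leaf => 1
  | node l r => l.size + r.size + 1

/-- The number of leaves. -/
def numLeaves : BisectionTree → ℕ
  | leaf => 1
  | node l r => l.numLeaves + r.numLeaves

/-- `T.IsSubdivisionTree B a b`: the bisection algorithm with predicate `B` terminates on the
initial interval `[a, b]`, and `T` is its subdivision tree. An interval on which `B` holds is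
terminal (a leaf); any other interval is bisected at its midpoint, and the algorithm continues
on the two halves. -/
def IsSubdivisionTree (B : ℝ → ℝ → Prop) : BisectionTree → ℝ → ℝ → Prop
  | leaf, a, b => B a b
  | node l r, a, b =>
      ¬ B a b ∧ l.IsSubdivisionTree B a ((a + b) / 2) ∧ r.IsSubdivisionTree B ((a + b) / 2) b

/-- The size of the tree is twice the number of intervals in the final partition, minus one. -/
theorem size_add_one (T : BisectionTree) : T.size + 1 = 2 * T.numLeaves := by
  induction T with
  | leaf => rfl
  | node l r hl hr => simp only [size, numLeaves]; omega

/-- The subdivision tree is determined by the predicate and the initial interval. -/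
theorem IsSubdivisionTree.unique {B : ℝ → ℝ → Prop} {T T' : BisectionTree} {a b : ℝ}
    (h : T.IsSubdivisionTree B a b) (h' : T'.IsSubdivisionTree B a b) : T = T' := by
  induction T generalizing T' a b with
  | leaf =>
    cases T' with
    | leaf => rfl
    | node l r => exact absurd h h'.1
  | node l r hl hr =>
    cases T' with
    | leaf => exact absurd h' h.1
    | node l' r' => rw [hl h.2.1 h'.2.1, hr h.2.2 h'.2.2]

end BisectionTree

/-- For `p` of degree `d`, the polynomial `(x + 1) ^ d * p ((a x + b) / (x + 1))`, written out as
`∑ i, p_i (a x + b) ^ i (x + 1) ^ (d - i)`. -/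
noncomputable def descartesTransform (p : Polynomial ℤ) (a b : ℝ) : Polynomial ℝ :=
  ∑ i ∈ Finset.range (p.natDegree + 1),
    Polynomial.C (p.coeff i : ℝ) * (Polynomial.C a * Polynomial.X + Polynomial.C b) ^ i *
      (Polynomial.X + 1) ^ (p.natDegree - i)

theorem descartesTransform_eval (p : Polynomial ℤ) (a b x : ℝ) (hx : x + 1 ≠ 0) :
    (descartesTransform p a b).eval x =
      (x + 1) ^ p.natDegree * Polynomial.aeval ((a * x + b) / (x + 1)) p := by
  rw [descartesTransform, Polynomial.eval_finsetSum, Polynomial.aeval_eq_sum_range,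
    Finset.mul_sum]
  refine Finset.sum_congr rfl fun i hi => ?_
  have hi' : i ≤ p.natDegree := Nat.lt_succ_iff.mp (Finset.mem_range.mp hi)
  have h : (x + 1) ^ p.natDegree = (x + 1) ^ (p.natDegree - i) * (x + 1) ^ i := by
    rw [← pow_add, Nat.sub_add_cancel hi']
  simp only [Polynomial.eval_mul, Polynomial.eval_pow, Polynomial.eval_add, Polynomial.eval_C,
    Polynomial.eval_X, Polynomial.eval_one, zsmul_eq_mul]
  rw [h, div_pow]
  field_simp

/-- The variation in the coefficients of `p` on the interval `(a, b)`: the number of sign changes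
(zeros being ignored) in the coefficient sequence of `(x + 1) ^ d * p ((a x + b) / (x + 1))`. -/
noncomputable def coeffVariation (p : Polynomial ℤ) (a b : ℝ) : ℕ :=
  (descartesTransform p a b).signVariations

/-- The predicate of the Descartes' rule of signs algorithm: true exactly when the coefficient
variation is `0` (exclusion) or `1` (inclusion). -/
def DescartesPredicate (p : Polynomial ℤ) (a b : ℝ) : Prop :=
  coeffVariation p a b = 0 ∨ coeffVariation p a b = 1

/-! Suppose Descartes' test fails on `[a, a + w]`. Then two distinct complex roots lie within `2 w`
of `a`. Indeed a real root or a conjugate pair farther away contributes to the transformed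
polynomial a factor whose coefficients are, up to a common sign, nonnegative and log-concave.
Products keep this property, so far roots alone give no sign change, and one more real linear factor
gives at most one (`exists_two_roots_of_not_descartesPredicate`).

Hence every non-terminal interval of width `u` can be charged to a root `z` near it whose separation
`δ z` is below `4 u`. At each depth a root pays for at most five intervals, and since widths halve,
it pays at about `log₂ (4 w / δ z)` depths. The tree size is thus governed by `∑ log (4 w / δ z)`
(`exists_subdivisionTree_size_le`, `sum_rootPotential_sub_le`).

Bounding the product of all separations at once, rather than each one by the worst case, saves a
factor `d` (`exists_separation_prod`). The derivative at `z` is at most an explicit factor times `δ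
z`, while the product of the derivatives over all roots is, up to a power of the leading
coefficient, a nonzero integer resultant. The powers of `max 1 ‖z‖` in the factors are controlled
together by the Mahler measure. This gives `-log ∏ δ z = O(d (L + log d))`. -/

open Polynomial

/-! ### Log-concave sequences -/

/-- A nonnegative bi-infinite sequence that is log-concave without internal zeros. -/
structure StrongLogConcave (g : ℤ → ℝ) : Prop where
  nonneg : ∀ k, 0 ≤ g k
  mul_le : ∀ i j, i ≤ j → g (i - 1) * g (j + 1) ≤ g i * g j

/-- Convolution with a nonnegative log-concave sequence of length three preserves
log-concavity. -/
theorem StrongLogConcave.quadratic {g : ℤ → ℝ} (hg : StrongLogConcave g) {A B C : ℝ}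
    (hA : 0 ≤ A) (hB : 0 ≤ B) (hC : 0 ≤ C) (hABC : A * C ≤ B ^ 2) :
    StrongLogConcave fun k => A * g (k - 2) + B * g (k - 1) + C * g k := by
  refine ⟨fun k => ?_, fun i j hij => ?_⟩
  · have := hg.nonneg
    have h1 := this (k - 2)
    have h2 := this (k - 1)
    have h3 := this k
    positivity
  have m1 := hg.mul_le i j hij
  have m2 := hg.mul_le (i - 1) (j - 1) (by omega)
  have m3 := hg.mul_le (i - 2) (j - 2) (by omega)
  have m4 := hg.mul_le (i - 1) j (by omega)
  have m5 := hg.mul_le (i - 2) (j - 1) (by omega)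
  have m6 := hg.mul_le (i - 2) j (by omega)
  have e1 : i - 1 - 1 = i - 2 := by ring
  have e2 : i - 2 - 1 = i - 3 := by ring
  have e3 : j - 1 + 1 = j := by ring
  have e4 : j - 2 + 1 = j - 1 := by ring
  have e5 : i - 1 - 2 = i - 3 := by ring
  have e6 : j + 1 - 2 = j - 1 := by ring
  have e7 : j + 1 - 1 = j := by ring
  simp only [e1, e2, e3, e4, e5, e6, e7] at m1 m2 m3 m4 m5 m6 ⊢
  have n1 : g (i - 1) * g j ≤ g i * g (j - 1) := by
    rcases hij.eq_or_lt with rfl | h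
    · exact le_of_eq (mul_comm _ _)
    · have := hg.mul_le i (j - 1) (by omega)
      rwa [e3] at this
  have n2 : g (i - 2) * g (j - 1) ≤ g (i - 1) * g (j - 2) := by
    rcases hij.eq_or_lt with rfl | h
    · exact le_of_eq (mul_comm _ _)
    · have := hg.mul_le (i - 1) (j - 2) (by omega)
      rwa [e1, e4] at this
  -- In the expanded difference of products, only the `A * C` term of `key` can be negative, and
  -- only for `i = j`. There it is the negative of the `B ^ 2` bracket, and `A * C ≤ B ^ 2`
  -- compensates for it.
  have key : 0 ≤ B ^ 2 * (g (i - 1) * g (j - 1) - g (i - 2) * g j)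
      + A * C * (g i * g (j - 2) - g (i - 1) * g (j - 1)) := by
    rcases hij.eq_or_lt with rfl | h
    · nlinarith [mul_nonneg (sub_nonneg.2 hABC) (sub_nonneg.2 m2)]
    · have h3 : g (i - 1) * g (j - 1) ≤ g i * g (j - 2) := by
        rcases (show i = j - 1 ∨ i ≤ j - 2 by omega) with rfl | h'
        · rw [show j - 1 - 1 = j - 2 by ring]; exact le_of_eq (mul_comm _ _)
        · have := hg.mul_le i (j - 2) h'
          rwa [e4] at this
      have := mul_nonneg (sq_nonneg B) (sub_nonneg.2 m2)
      have := mul_nonneg (mul_nonneg hA hC) (sub_nonneg.2 h3)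
      linarith
  have t1 := mul_nonneg (mul_nonneg hC hC) (sub_nonneg.2 m1)
  have t2 := mul_nonneg (mul_nonneg hA hA) (sub_nonneg.2 m3)
  have t3 := mul_nonneg (mul_nonneg hB hC) (sub_nonneg.2 (m4.trans n1))
  have t4 := mul_nonneg (mul_nonneg hA hB) (sub_nonneg.2 (m5.trans n2))
  have t5 := mul_nonneg (mul_nonneg hA hC) (sub_nonneg.2 m6)
  linarith

/-! ### Coefficient sequences and sign variations -/

/-- The coefficient sequence of a polynomial, extended by zero to negative indices. -/
def intCoeff (f : ℝ[X]) (k : ℤ) : ℝ := if k < 0 then 0 else f.coeff k.toNat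

@[simp] theorem intCoeff_natCast (f : ℝ[X]) (k : ℕ) : intCoeff f k = f.coeff k := by
  simp [intCoeff]

theorem intCoeff_mul_quadratic (f : ℝ[X]) (a b c : ℝ) (k : ℤ) :
    intCoeff (f * (C a * X ^ 2 + C b * X + C c)) k =
      a * intCoeff f (k - 2) + b * intCoeff f (k - 1) + c * intCoeff f k := by
  have e : f * (C a * X ^ 2 + C b * X + C c) = C a * (f * X ^ 2) + C b * (f * X) + C c * f := by
    ring
  rcases lt_or_ge k 0 with hk | hk
  · simp [intCoeff, hk, show k - 2 < 0 by omega, show k - 1 < 0 by omega]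
  lift k to ℕ using hk
  rw [e]
  match k with
  | 0 => simp [intCoeff]
  | 1 => simp [intCoeff, coeff_mul_X_pow']
  | k + 2 =>
    have h1 : ((k + 2 : ℕ) : ℤ) - 2 = (k : ℕ) := by push_cast; ring
    have h2 : ((k + 2 : ℕ) : ℤ) - 1 = ((k + 1 : ℕ) : ℤ) := by push_cast; ring
    rw [h1, h2]
    simp only [intCoeff_natCast, coeff_add, coeff_C_mul, coeff_mul_X_pow]
    rw [coeff_mul_X]

theorem signVariations_eq_zero_of_coeff_nonneg (f : ℝ[X]) (h : ∀ k, 0 ≤ f.coeff k) :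
    f.signVariations = 0 := by
  induction hn : f.support.card using Nat.strong_induction_on generalizing f with
  | _ n ih =>
    by_cases hf : f = 0
    · simp [hf]
    have hE : ∀ k, 0 ≤ f.eraseLead.coeff k := fun k => by
      rw [eraseLead_coeff]; split_ifs <;> simp [h]
    rw [signVariations_eq_eraseLead_add_ite hf,
      ih _ (hn ▸ eraseLead_support_card_lt hf) _ hE rfl, if_neg, add_zero]
    have h1 : 0 < f.leadingCoeff := lt_of_le_of_ne (h _) (Ne.symm (leadingCoeff_ne_zero.2 hf))
    have h2 : 0 ≤ f.eraseLead.leadingCoeff := hE _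
    rw [sign_pos h1]
    rcases h2.eq_or_lt with h2 | h2
    · rw [← h2]; simp
    · rw [sign_pos h2]; decide

/-- If no negative coefficient is followed by a positive one, there is at most one sign change. -/
theorem signVariations_le_one (f : ℝ[X])
    (h : ∀ k l, k < l → f.coeff k < 0 → f.coeff l ≤ 0) : f.signVariations ≤ 1 := by
  have key : ∀ q : ℝ[X], (∀ k l, k < l → q.coeff k < 0 → q.coeff l ≤ 0) → 0 < q.leadingCoeff →
      q.signVariations = 0 := by
    intro q hq hl
    refine signVariations_eq_zero_of_coeff_nonneg q fun k => ?_
    by_contra! hk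
    rcases lt_trichotomy k q.natDegree with h1 | h1 | h1
    · exact absurd (hq _ _ h1 hk) (not_le.2 hl)
    · rw [h1] at hk; exact absurd hk (not_lt.2 hl.le)
    · rw [coeff_eq_zero_of_natDegree_lt h1] at hk; exact lt_irrefl _ hk
  induction hn : f.support.card using Nat.strong_induction_on generalizing f with
  | _ n ih =>
    by_cases hf : f = 0
    · simp [hf]
    rcases lt_or_gt_of_ne (leadingCoeff_ne_zero.2 hf) with hl | hl
    swap
    · rw [key f h hl]; exact zero_le_one
    have hE : ∀ k l, k < l → f.eraseLead.coeff k < 0 → f.eraseLead.coeff l ≤ 0 := by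
      intro k l hkl hk
      rw [eraseLead_coeff] at hk ⊢
      by_cases hk' : k = f.natDegree
      · rw [if_pos hk'] at hk; exact absurd hk (lt_irrefl _)
      rw [if_neg hk'] at hk
      split_ifs
      · exact le_rfl
      · exact h _ _ hkl hk
    rw [signVariations_eq_eraseLead_add_ite hf]
    rcases lt_or_ge 0 f.eraseLead.leadingCoeff with h2 | h2
    · rw [key _ hE h2]; split_ifs <;> simp
    · rw [if_neg, add_zero]
      · exact ih _ (hn ▸ eraseLead_support_card_lt hf) _ hE rfl
      · rw [sign_neg hl]
        rcases h2.eq_or_lt with h2 | h2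
        · rw [h2]; simp
        · rw [sign_neg h2]; decide

theorem signVariations_C_mul_le (c : ℝ) (f : ℝ[X]) :
    (C c * f).signVariations ≤ f.signVariations := by
  rcases eq_or_ne c 0 with rfl | hc
  · simp
  · rw [signVariations_C_mul f hc]

/-- The coefficients are `s q_{k-1} + t q_k`, and log-concavity makes the ratio `q_k / q_{k-1}`
nonincreasing. So for `s ≤ 0` no positive coefficient follows a negative one; negation handles `s ≥
0`. -/
theorem StrongLogConcave.signVariations_mul_linear_le_one {q : ℝ[X]}
    (hq : StrongLogConcave (intCoeff q)) (s t : ℝ) :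
    (q * (C s * X + C t)).signVariations ≤ 1 := by
  have hc : ∀ k : ℕ, (q * (C s * X + C t)).coeff k =
      s * intCoeff q ((k : ℤ) - 1) + t * intCoeff q k := by
    intro k
    have := intCoeff_mul_quadratic q 0 s t k
    rw [intCoeff_natCast] at this
    simpa using this
  have hn := hq.nonneg
  have main : ∀ s t : ℝ, s ≤ 0 → ∀ k l : ℤ, k < l →
      s * intCoeff q (k - 1) + t * intCoeff q k < 0 →
      s * intCoeff q (l - 1) + t * intCoeff q l ≤ 0 := by
    intro s t hs k l hkl hk
    rcases le_total t 0 with ht | ht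
    · nlinarith [mul_nonneg (neg_nonneg.2 hs) (hn (l - 1)), mul_nonneg (neg_nonneg.2 ht) (hn l)]
    have hpos : 0 < intCoeff q (k - 1) := by
      refine lt_of_le_of_ne (hn _) fun h => ?_
      rw [← h] at hk
      have := mul_nonneg ht (hn k)
      linarith
    have hm := hq.mul_le k (l - 1) (by omega)
    rw [show l - 1 + 1 = l by ring] at hm
    have h1 : t * (intCoeff q (k - 1) * intCoeff q l) ≤
        t * (intCoeff q k * intCoeff q (l - 1)) := mul_le_mul_of_nonneg_left hm ht
    have h2 : (s * intCoeff q (k - 1) + t * intCoeff q k) * intCoeff q (l - 1) ≤ 0 :=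
      mul_nonpos_of_nonpos_of_nonneg hk.le (hn _)
    by_contra! hcon
    have := mul_pos hpos hcon
    nlinarith
  rcases le_total s 0 with hs | hs
  · refine signVariations_le_one _ fun k l hkl => ?_
    rw [hc, hc]
    exact main s t hs k l (by exact_mod_cast hkl)
  · rw [← signVariations_neg]
    refine signVariations_le_one _ fun k l hkl => ?_
    rw [coeff_neg, coeff_neg, hc, hc]
    have := main (-s) (-t) (by linarith) k l (by exact_mod_cast hkl)
    intro h
    have := this (by linarith)
    linarith

/-! ### The Möbius transform and its factors -/

/-- For `f` of degree `d`, the polynomial `(x + 1) ^ d * f ((a x + b) / (x + 1))`. -/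
noncomputable def mobiusTransform (f : ℝ[X]) (a b : ℝ) : ℝ[X] :=
  ∑ i ∈ Finset.range (f.natDegree + 1),
    C (f.coeff i) * (C a * X + C b) ^ i * (X + 1) ^ (f.natDegree - i)

theorem mobiusTransform_eval (f : ℝ[X]) (a b x : ℝ) (hx : x + 1 ≠ 0) :
    (mobiusTransform f a b).eval x = (x + 1) ^ f.natDegree * f.eval ((a * x + b) / (x + 1)) := by
  rw [mobiusTransform, eval_finsetSum, eval_eq_sum_range, Finset.mul_sum]
  refine Finset.sum_congr rfl fun i hi => ?_
  have hi' : i ≤ f.natDegree := Nat.lt_succ_iff.mp (Finset.mem_range.mp hi)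
  have h : (x + 1) ^ f.natDegree = (x + 1) ^ (f.natDegree - i) * (x + 1) ^ i := by
    rw [← pow_add, Nat.sub_add_cancel hi']
  simp only [eval_mul, eval_pow, eval_add, eval_C, eval_X, eval_one]
  rw [h, div_pow]
  field_simp

/-- Two polynomials agreeing at all `x > 0` coincide, so multiplicativity and the explicit factors
below reduce to identities of rational functions away from `x = -1`. -/
theorem mobiusTransform_eq (f q : ℝ[X]) (a b : ℝ)
    (h : ∀ x : ℝ, x + 1 ≠ 0 → q.eval x = (x + 1) ^ f.natDegree * f.eval ((a * x + b) / (x + 1))) :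
    mobiusTransform f a b = q := by
  refine eq_of_infinite_eval_eq _ _ ((Set.Ioi_infinite (0 : ℝ)).mono fun x hx => ?_)
  have hx' : x + 1 ≠ 0 := by have : (0 : ℝ) < x := hx; positivity
  simp only [Set.mem_ofPred_eq]
  rw [mobiusTransform_eval f a b x hx', h x hx']

theorem mobiusTransform_mul {f g : ℝ[X]} (hf : f ≠ 0) (hg : g ≠ 0) (a b : ℝ) :
    mobiusTransform (f * g) a b = mobiusTransform f a b * mobiusTransform g a b := by
  refine mobiusTransform_eq _ _ _ _ fun x hx => ?_
  rw [eval_mul, mobiusTransform_eval _ _ _ _ hx, mobiusTransform_eval _ _ _ _ hx,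
    natDegree_mul hf hg, pow_add, eval_mul]
  ring

theorem mobiusTransform_X_sub_C (r a b : ℝ) :
    mobiusTransform (X - C r) a b = C (a - r) * X + C (b - r) := by
  refine mobiusTransform_eq _ _ _ _ fun x hx => ?_
  rw [natDegree_X_sub_C]
  simp
  field_simp
  ring

theorem mobiusTransform_quadratic (s t a b : ℝ) :
    mobiusTransform (X ^ 2 - C s * X + C t) a b =
      C (a ^ 2 - s * a + t) * X ^ 2 + C (2 * a * b - s * (a + b) + 2 * t) * X +
        C (b ^ 2 - s * b + t) := by
  have hd : (X ^ 2 - C s * X + C t : ℝ[X]).natDegree = 2 := by compute_degree!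
  refine mobiusTransform_eq _ _ _ _ fun x hx => ?_
  rw [hd]
  simp
  field_simp
  ring

theorem mobiusTransform_map (p : ℤ[X]) (a b : ℝ) :
    mobiusTransform (p.map (Int.castRingHom ℝ)) a b = descartesTransform p a b := by
  rw [mobiusTransform, descartesTransform,
    natDegree_map_eq_of_injective (RingHom.injective_int _)]
  simp

/-! ### A failed test forces two nearby roots -/

/-- If all roots are far from the interval, the transformed coefficients are log-concave. -/
theorem exists_strongLogConcave_mobiusTransform {a w : ℝ} (hw : 0 < w) (f : ℝ[X]) (hf : f ≠ 0)
    (hroots : ∀ z : ℂ, aeval z f = 0 → 2 * w ≤ ‖z - a‖) :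
    ∃ (c : ℝ) (q : ℝ[X]), StrongLogConcave (intCoeff q) ∧
      mobiusTransform f a (a + w) = C c * q := by
  induction hn : f.natDegree using Nat.strong_induction_on generalizing f with
  | _ n ih =>
    rcases Nat.eq_zero_or_pos f.natDegree with h0 | h0
    · refine ⟨f.coeff 0, 1, ⟨fun k => ?_, fun i j hij => ?_⟩, ?_⟩
      · unfold intCoeff; split_ifs
        · exact le_rfl
        · rw [coeff_one]; split_ifs <;> norm_num
      · have h1 : intCoeff 1 (i - 1) * intCoeff 1 (j + 1) = 0 := by
          unfold intCoeff
          rcases lt_or_ge (i - 1) 0 with h | h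
          · simp [h]
          · rw [if_neg (by omega : ¬ j + 1 < 0), coeff_one, coeff_one,
              if_neg (by omega : ¬ (j + 1).toNat = 0), mul_zero]
        rw [h1]
        have hpos : ∀ k, 0 ≤ intCoeff 1 k := fun k => by
          unfold intCoeff; split_ifs
          · exact le_rfl
          · rw [coeff_one]; split_ifs <;> norm_num
        exact mul_nonneg (hpos _) (hpos _)
      · rw [mobiusTransform, h0]; simp
    obtain ⟨z, hz⟩ := IsAlgClosed.exists_aeval_eq_zero ℂ f (by
      rw [degree_eq_natDegree hf]; exact_mod_cast h0.ne')
    have hza := hroots z hz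
    by_cases him : z.im = 0
    · have hzr : z = (z.re : ℂ) := Complex.ext rfl (by simp [him])
      obtain ⟨r, rfl⟩ : ∃ r : ℝ, z = r := ⟨_, hzr⟩
      have hr : f.IsRoot r := by
        have : (algebraMap ℝ ℂ) (f.eval r) = 0 := by
          rw [← aeval_algebraMap_apply_eq_algebraMap_eval]; exact hz
        simpa using this
      obtain ⟨g, rfl⟩ := dvd_iff_isRoot.2 hr
      have hg : g ≠ 0 := right_ne_zero_of_mul hf
      have hdeg : g.natDegree < n := by
        rw [natDegree_mul (X_sub_C_ne_zero r) hg, natDegree_X_sub_C] at hn; omega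
      obtain ⟨c, q, hq, he⟩ := ih _ hdeg g hg
        (fun z hz => hroots z (by rw [map_mul, hz, mul_zero])) rfl
      have habs : 2 * w ≤ |r - a| := by
        have : ‖(r : ℂ) - a‖ = |r - a| := by rw [← Complex.ofReal_sub, Complex.norm_real]; rfl
        rwa [this] at hza
      rcases le_abs.1 habs with h | h
      -- For a root to the right of the interval both coefficients of the linear factor are
      -- negative; the sign moves into the constant.
      · refine ⟨-c, q * (C 0 * X ^ 2 + C (r - a) * X + C (r - (a + w))), ?_, ?_⟩
        · have := hq.quadratic (A := 0) (B := r - a) (C := r - (a + w)) le_rfl (by linarith)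
            (by linarith) (by nlinarith [sq_nonneg (r - a)])
          convert! this using 1
          funext k; exact intCoeff_mul_quadratic _ _ _ _ _
        · rw [mobiusTransform_mul (X_sub_C_ne_zero r) hg, he, mobiusTransform_X_sub_C]
          simp only [C_sub, C_neg, C_0]; ring
      · refine ⟨c, q * (C 0 * X ^ 2 + C (a - r) * X + C (a + w - r)), ?_, ?_⟩
        · have := hq.quadratic (A := 0) (B := a - r) (C := a + w - r) le_rfl (by linarith)
            (by linarith) (by nlinarith [sq_nonneg (a - r)])
          convert! this using 1
          funext k; exact intCoeff_mul_quadratic _ _ _ _ _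
        · rw [mobiusTransform_mul (X_sub_C_ne_zero r) hg, he, mobiusTransform_X_sub_C]
          simp only [C_sub, C_0]; ring
    · obtain ⟨g, hfg⟩ := f.quadratic_dvd_of_aeval_eq_zero_im_ne_zero hz him
      set Q : ℝ[X] := X ^ 2 - C (2 * z.re) * X + C (‖z‖ ^ 2) with hQ
      have hQd : Q.natDegree = 2 := by rw [hQ]; compute_degree!
      have hQ0 : Q ≠ 0 := fun h => by simp [h] at hQd
      have hg : g ≠ 0 := by rintro rfl; exact hf (by rw [hfg, mul_zero])
      have hdeg : g.natDegree < n := by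
        rw [hfg, natDegree_mul hQ0 hg, hQd] at hn; omega
      obtain ⟨c, q, hq, he⟩ := ih _ hdeg g hg
        (fun z hz => hroots z (by rw [hfg, map_mul, hz, mul_zero])) rfl
      have hnz : ‖z‖ ^ 2 = z.re ^ 2 + z.im ^ 2 := by
        rw [Complex.sq_norm, Complex.normSq_apply]; ring
      have hsq : 4 * w ^ 2 ≤ (a - z.re) ^ 2 + z.im ^ 2 := by
        have h1 : ‖z - a‖ ^ 2 = (a - z.re) ^ 2 + z.im ^ 2 := by
          rw [Complex.sq_norm, Complex.normSq_apply]; simp; ring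
        rw [← h1]
        nlinarith [norm_nonneg (z - a)]
      -- The conjugate pair becomes `m X² + 2 (m + t) X + (m + 2 t + w²)` with `m = ‖z - a‖²`. The
      -- distance hypothesis says `w² ≤ m / 4`, whence `|t| ≤ m / 2`; this makes the coefficients
      -- nonnegative and log-concave.
      set m := (a - z.re) ^ 2 + z.im ^ 2 with hm
      set t := w * (a - z.re) with ht
      have hm0 : 0 ≤ m := by positivity
      have htm : |t| ≤ m / 2 := by
        refine abs_le_of_sq_le_sq ?_ (by positivity)
        have : (a - z.re) ^ 2 ≤ m := by nlinarith [sq_nonneg z.im]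
        calc t ^ 2 = w ^ 2 * (a - z.re) ^ 2 := by rw [ht]; ring
          _ ≤ (m / 4) * m := by gcongr; linarith
          _ = (m / 2) ^ 2 := by ring
      have htl := (abs_le.1 htm).1
      have htu := (abs_le.1 htm).2
      have eA : a ^ 2 - 2 * z.re * a + ‖z‖ ^ 2 = m := by rw [hnz, hm]; ring
      have eB : 2 * a * (a + w) - 2 * z.re * (a + (a + w)) + 2 * ‖z‖ ^ 2 = 2 * (m + t) := by
        rw [hnz, hm, ht]; ring
      have eC : (a + w) ^ 2 - 2 * z.re * (a + w) + ‖z‖ ^ 2 = m + 2 * t + w ^ 2 := by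
        rw [hnz, hm, ht]; ring
      refine ⟨c, q * (C m * X ^ 2 + C (2 * (m + t)) * X + C (m + 2 * t + w ^ 2)), ?_, ?_⟩
      · have := hq.quadratic (A := m) (B := 2 * (m + t)) (C := m + 2 * t + w ^ 2) hm0
          (by linarith) (by nlinarith) (by
            have : m * w ^ 2 ≤ m * (m / 4) := by gcongr; linarith
            nlinarith [sq_nonneg (3 * m + 4 * t)])
        convert! this using 1
        funext k; exact intCoeff_mul_quadratic _ _ _ _ _
      · rw [hfg, mobiusTransform_mul hQ0 hg, he, hQ, mobiusTransform_quadratic, eA, eB, eC]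
        ring

/-- If the Descartes predicate fails on `[a, a + w]`, then the polynomial has two distinct roots
within distance `2 w` of `a`. -/
theorem exists_two_roots_of_not_descartesPredicate {p : ℤ[X]}
    (hsf : (p.map (Int.castRingHom ℂ)).roots.Nodup) (hp : p ≠ 0) {a w : ℝ} (hw : 0 < w)
    (h : ¬ DescartesPredicate p a (a + w)) :
    ∃ z z' : ℂ, z ∈ (p.map (Int.castRingHom ℂ)).roots ∧ z' ∈ (p.map (Int.castRingHom ℂ)).roots ∧
      z ≠ z' ∧ ‖z - a‖ < 2 * w ∧ ‖z' - a‖ < 2 * w := by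
  have hpC : p.map (Int.castRingHom ℂ) ≠ 0 := (Polynomial.map_ne_zero_iff (RingHom.injective_int _)).2 hp
  have hpR : p.map (Int.castRingHom ℝ) ≠ 0 := (Polynomial.map_ne_zero_iff (RingHom.injective_int _)).2 hp
  have hmap : p.map (Int.castRingHom ℂ) = (p.map (Int.castRingHom ℝ)).map (algebraMap ℝ ℂ) := by
    rw [map_map]; congr 1
  set f := p.map (Int.castRingHom ℝ) with hf
  have hmem : ∀ z : ℂ, z ∈ (p.map (Int.castRingHom ℂ)).roots ↔ aeval z f = 0 := by
    intro z
    rw [mem_roots hpC, IsRoot, hmap, eval_map_algebraMap]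
  contrapose! h
  have hle : coeffVariation p a (a + w) ≤ 1 := by
    rw [coeffVariation, ← mobiusTransform_map, ← hf]
    by_cases hex : ∃ z : ℂ, aeval z f = 0 ∧ ‖z - a‖ < 2 * w
    · obtain ⟨z, hz, hza⟩ := hex
      -- The conjugate of a close root is equally close to the real point `a`, so a sole close root
      -- is real and splits off a linear factor.
      have hconj : aeval ((starRingEnd ℂ) z) f = 0 := by
        rw [aeval_conj, hz, map_zero]
      have hza' : ‖(starRingEnd ℂ) z - a‖ < 2 * w := by
        have : (starRingEnd ℂ) z - a = (starRingEnd ℂ) (z - a) := by simp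
        rw [this, Complex.norm_conj]; exact hza
      have hreal : (starRingEnd ℂ) z = z := by
        by_contra hne
        exact absurd (h z _ ((hmem _).2 hz) ((hmem _).2 hconj) (Ne.symm hne) hza) (not_le.2 hza')
      obtain ⟨r, rfl⟩ := Complex.conj_eq_iff_real.1 hreal
      have hr : f.IsRoot r := by
        have : (algebraMap ℝ ℂ) (f.eval r) = 0 := by
          rw [← aeval_algebraMap_apply_eq_algebraMap_eval]; exact hz
        simpa using this
      obtain ⟨g, hg⟩ := dvd_iff_isRoot.2 hr
      have hg0 : g ≠ 0 := by rintro rfl; exact hpR (by rw [hg, mul_zero])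
      obtain ⟨c, q, hq, he⟩ := exists_strongLogConcave_mobiusTransform (a := a) hw g hg0 (by
        intro y hy
        by_contra! hya
        have hyf : aeval y f = 0 := by rw [hg, map_mul, hy, mul_zero]
        by_cases hyr : (r : ℂ) = y
        -- If `r` were also a root of the cofactor, it would be a double root of `p`.
        · rw [← hyr] at hy
          have hroots : (p.map (Int.castRingHom ℂ)).roots =
              (r : ℂ) ::ₘ (g.map (algebraMap ℝ ℂ)).roots := by
            rw [hmap, hg, Polynomial.map_mul, roots_mul, Polynomial.map_sub, map_X, map_C,
              roots_X_sub_C]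
            · rfl
            · rw [← Polynomial.map_mul, ← hg, ← hmap]; exact hpC
          rw [hroots, Multiset.nodup_cons] at hsf
          refine hsf.1 ((mem_roots ?_).2 ?_)
          · exact (Polynomial.map_ne_zero_iff (algebraMap ℝ ℂ).injective).2 hg0
          · rw [IsRoot, eval_map_algebraMap]; exact hy
        · exact absurd (h _ y ((hmem _).2 hz) ((hmem _).2 hyf) hyr hza) (not_le.2 hya))
      rw [hg, mobiusTransform_mul (X_sub_C_ne_zero r) hg0, he, mobiusTransform_X_sub_C]
      have : (C (a - r) * X + C (a + w - r)) * (C c * q) =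
          C c * (q * (C (a - r) * X + C (a + w - r))) := by ring
      rw [this]
      exact (signVariations_C_mul_le _ _).trans (hq.signVariations_mul_linear_le_one _ _)
    · push Not at hex
      obtain ⟨c, q, hq, he⟩ := exists_strongLogConcave_mobiusTransform hw f hpR hex
      rw [he]
      refine (signVariations_C_mul_le _ _).trans ?_
      rw [signVariations_eq_zero_of_coeff_nonneg q fun k => by
        rw [← intCoeff_natCast]; exact hq.nonneg _]
      exact zero_le_one
  unfold DescartesPredicate
  omega

/-! ### Root separation and the derivative -/

/-- Second order Taylor estimate for a power. -/
theorem norm_pow_sub_pow_sub_le {x y : ℂ} {R : ℝ} (hR : 1 ≤ R) (hx : ‖x‖ ≤ R) (hy : ‖y‖ ≤ R)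
    (n : ℕ) : ‖y ^ n - x ^ n - n * x ^ (n - 1) * (y - x)‖ ≤ n ^ 2 * R ^ n * ‖y - x‖ ^ 2 := by
  induction n with
  | zero => simp
  | succ n ih =>
    have e : y ^ (n + 1) - x ^ (n + 1) - ((n + 1 : ℕ) : ℂ) * x ^ (n + 1 - 1) * (y - x) =
        y * (y ^ n - x ^ n - n * x ^ (n - 1) * (y - x)) + n * x ^ (n - 1) * (y - x) ^ 2 := by
      rcases n with _ | n
      · simp
      · simp only [Nat.add_sub_cancel]; push_cast; ring
    have hp : ‖x‖ ^ (n - 1) ≤ R ^ (n + 1) :=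
      (pow_le_pow_left₀ (norm_nonneg _) hx _).trans (pow_le_pow_right₀ hR (by omega))
    rw [e]
    calc _ ≤ ‖y‖ * ‖y ^ n - x ^ n - n * x ^ (n - 1) * (y - x)‖ +
          n * ‖x‖ ^ (n - 1) * ‖y - x‖ ^ 2 := by
          refine (norm_add_le _ _).trans (le_of_eq ?_)
          simp only [norm_mul, norm_pow, Complex.norm_natCast]
      _ ≤ R * (n ^ 2 * R ^ n * ‖y - x‖ ^ 2) + n * R ^ (n + 1) * ‖y - x‖ ^ 2 := by gcongr
      _ = (n ^ 2 + n) * (R ^ (n + 1) * ‖y - x‖ ^ 2) := by ring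
      _ ≤ ((n + 1 : ℕ) : ℝ) ^ 2 * (R ^ (n + 1) * ‖y - x‖ ^ 2) := by
          gcongr; push_cast; nlinarith [(Nat.cast_nonneg n : (0 : ℝ) ≤ n)]
      _ = _ := by ring

theorem eval_derivative_eq_sum_range {f : ℂ[X]} (x : ℂ) :
    f.derivative.eval x =
      ∑ i ∈ Finset.range (f.natDegree + 1), f.coeff i * (i * x ^ (i - 1)) := by
  rw [derivative_eval, sum_over_range]
  · simp only [mul_assoc]
  · simp

theorem norm_eval_derivative_le {f : ℂ[X]} {B : ℝ} (hB : ∀ i, ‖f.coeff i‖ ≤ B) (x : ℂ) :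
    ‖f.derivative.eval x‖ ≤
      (f.natDegree + 1) * (f.natDegree * B) * max 1 ‖x‖ ^ f.natDegree := by
  have hB0 : 0 ≤ B := (norm_nonneg _).trans (hB 0)
  rw [eval_derivative_eq_sum_range]
  calc _ ≤ ∑ i ∈ Finset.range (f.natDegree + 1),
        f.natDegree * B * max 1 ‖x‖ ^ f.natDegree := by
        refine norm_sum_le_of_le _ fun i hi => ?_
        have hi' : i ≤ f.natDegree := Nat.lt_succ_iff.mp (Finset.mem_range.mp hi)
        rw [norm_mul, norm_mul, norm_pow, Complex.norm_natCast]
        have h1 : ‖x‖ ^ (i - 1) ≤ max 1 ‖x‖ ^ f.natDegree :=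
          (pow_le_pow_left₀ (norm_nonneg _) (le_max_right _ _) _).trans
            (pow_le_pow_right₀ (le_max_left _ _) (by omega))
        calc _ ≤ B * (f.natDegree * max 1 ‖x‖ ^ f.natDegree) := by
              gcongr; exact hB i
          _ = _ := by ring
    _ = _ := by rw [Finset.sum_const, Finset.card_range, nsmul_eq_mul]; push_cast; ring

/-- At a root with another root close by, the derivative is small. -/
theorem norm_eval_derivative_le_mul_norm_sub {f : ℂ[X]} {B R : ℝ} (hB : ∀ i, ‖f.coeff i‖ ≤ B)
    (hR : 1 ≤ R) {x y : ℂ} (hx : ‖x‖ ≤ R) (hy : ‖y‖ ≤ R) (hfx : f.eval x = 0)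
    (hfy : f.eval y = 0) (hxy : x ≠ y) :
    ‖f.derivative.eval x‖ ≤
      (f.natDegree + 1) * (f.natDegree ^ 2 * B) * R ^ f.natDegree * ‖x - y‖ := by
  have hB0 : 0 ≤ B := (norm_nonneg _).trans (hB 0)
  have hpos : 0 < ‖y - x‖ := norm_pos_iff.2 (sub_ne_zero.2 hxy.symm)
  -- As `f` vanishes at `x` and `y`, the linear Taylor term equals minus the second order remainder,
  -- which is `O(‖y - x‖²)`; one factor `‖y - x‖` then cancels.
  have e : -(f.derivative.eval x * (y - x)) = ∑ i ∈ Finset.range (f.natDegree + 1),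
      f.coeff i * (y ^ i - x ^ i - i * x ^ (i - 1) * (y - x)) := by
    have h0 : -(f.derivative.eval x * (y - x)) =
        f.eval y - f.eval x - f.derivative.eval x * (y - x) := by rw [hfx, hfy]; ring
    rw [h0, eval_derivative_eq_sum_range, eval_eq_sum_range, eval_eq_sum_range, Finset.sum_mul,
      ← Finset.sum_sub_distrib, ← Finset.sum_sub_distrib]
    exact Finset.sum_congr rfl fun i _ => by ring
  have h1 : ‖f.derivative.eval x‖ * ‖y - x‖ ≤
      (f.natDegree + 1) * (f.natDegree ^ 2 * B) * R ^ f.natDegree * ‖y - x‖ * ‖y - x‖ := by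
    rw [← norm_mul, ← norm_neg, e]
    calc _ ≤ ∑ i ∈ Finset.range (f.natDegree + 1),
          B * (f.natDegree ^ 2 * R ^ f.natDegree * ‖y - x‖ ^ 2) := by
          refine norm_sum_le_of_le _ fun i hi => ?_
          have hi' : i ≤ f.natDegree := Nat.lt_succ_iff.mp (Finset.mem_range.mp hi)
          rw [norm_mul]
          refine mul_le_mul (hB i) ((norm_pow_sub_pow_sub_le hR hx hy i).trans ?_)
            (norm_nonneg _) hB0
          gcongr
      _ = _ := by rw [Finset.sum_const, Finset.card_range, nsmul_eq_mul]; push_cast; ring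
  rw [norm_sub_rev x y]
  exact le_of_mul_le_mul_right h1 hpos

/-- Every root has a truncated separation `δ` from the other roots that controls the derivative
from above. -/
theorem exists_separation {f : ℂ[X]} {B : ℝ} (hB : ∀ i, ‖f.coeff i‖ ≤ B)
    (hd : 1 ≤ f.natDegree) {x : ℂ} (hx : x ∈ f.roots) :
    ∃ δ : ℝ, 0 < δ ∧ δ ≤ 1 ∧ (∀ y ∈ f.roots, x ≠ y → δ ≤ ‖x - y‖) ∧
      ‖f.derivative.eval x‖ ≤
        (f.natDegree + 1) * (f.natDegree ^ 2 * B) * (3 * max 1 ‖x‖ ^ f.natDegree) * δ := by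
  classical
  have hB0 : 0 ≤ B := (norm_nonneg _).trans (hB 0)
  set d := f.natDegree with hdd
  have hd0 : (0 : ℝ) < d := by exact_mod_cast hd
  have hd1 : (1 : ℝ) ≤ d := by exact_mod_cast hd
  -- Truncating at `1 / d` keeps a nearest root at distance `δ` within modulus `(1 + 1 / d) * max 1
  -- ‖x‖`. The `d`-th power of this costs only `(1 + 1 / d) ^ d ≤ e ≤ 3`. When `1 / d` is the
  -- minimum, the direct derivative bound suffices.
  set S : Finset ℝ := insert (1 / d : ℝ) ((f.roots.toFinset.erase x).image fun y => ‖x - y‖)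
  obtain ⟨δ, hδS, hmin⟩ := S.exists_min_image id ⟨_, Finset.mem_insert_self _ _⟩
  simp only [id] at hmin
  have hδd : δ ≤ 1 / d := hmin _ (Finset.mem_insert_self _ _)
  have hM : 1 ≤ max 1 ‖x‖ := le_max_left _ _
  refine ⟨δ, ?_, hδd.trans ((div_le_one hd0).2 hd1), fun y hy hxy => hmin _ ?_, ?_⟩
  · rcases Finset.mem_insert.1 hδS with h | h
    · rw [h]; positivity
    · obtain ⟨y, hy, rfl⟩ := Finset.mem_image.1 h
      exact norm_pos_iff.2 (sub_ne_zero.2 (Finset.ne_of_mem_erase hy).symm)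
  · exact Finset.mem_insert_of_mem (Finset.mem_image_of_mem _
      (Finset.mem_erase.2 ⟨hxy.symm, Multiset.mem_toFinset.2 hy⟩))
  · rcases Finset.mem_insert.1 hδS with h | h
    · rw [h]
      refine (norm_eval_derivative_le hB x).trans ?_
      rw [← hdd]
      have : ((d : ℝ) + 1) * (d ^ 2 * B) * (3 * max 1 ‖x‖ ^ d) * (1 / d) =
          3 * ((d + 1) * (d * B) * max 1 ‖x‖ ^ d) := by field_simp
      rw [this]
      have : 0 ≤ ((d : ℝ) + 1) * (d * B) * max 1 ‖x‖ ^ d := by positivity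
      linarith
    · obtain ⟨y, hy, rfl⟩ := Finset.mem_image.1 h
      have hy' := Finset.mem_erase.1 hy
      have hyr : f.eval y = 0 := (mem_roots'.1 (Multiset.mem_toFinset.1 hy'.2)).2
      have hxr : f.eval x = 0 := (mem_roots'.1 hx).2
      set R := (1 + 1 / (d : ℝ)) * max 1 ‖x‖ with hRdef
      have hMR : max 1 ‖x‖ ≤ R := le_mul_of_one_le_left (by positivity) (by
        have : 0 < 1 / (d : ℝ) := by positivity
        linarith)
      have hyR : ‖y‖ ≤ R := by
        have h1 : ‖y‖ ≤ ‖x‖ + ‖x - y‖ := by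
          have := norm_sub_le x (x - y)
          simpa using this
        have h2 : 1 / (d : ℝ) ≤ 1 / d * max 1 ‖x‖ := le_mul_of_one_le_right (by positivity) hM
        have h3 := le_max_right 1 ‖x‖
        have hδd' : ‖x - y‖ ≤ 1 / d := hδd
        rw [hRdef]; linarith
      have := norm_eval_derivative_le_mul_norm_sub hB (hM.trans hMR)
        ((le_max_right _ _).trans hMR) hyR hxr hyr hy'.1.symm
      refine this.trans ?_
      rw [← hdd]
      gcongr
      rw [hRdef, mul_pow]
      gcongr
      calc (1 + 1 / (d : ℝ)) ^ d ≤ Real.exp (1 / d) ^ d := by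
            gcongr; rw [add_comm]; exact Real.add_one_le_exp _
        _ = Real.exp 1 := by rw [← Real.exp_nat_mul]; congr 1; field_simp
        _ ≤ 3 := (Real.exp_one_lt_d9.trans (by norm_num)).le

/-! ### Resultant, Mahler measure and the product of separations -/

theorem eval_derivative_ne_zero_of_nodup_roots {f : ℂ[X]} (hf : f ≠ 0) (hnd : f.roots.Nodup)
    {z : ℂ} (hz : z ∈ f.roots) : f.derivative.eval z ≠ 0 := by
  intro h
  have h1 := (one_lt_rootMultiplicity_iff_isRoot hf).2 ⟨(mem_roots hf).1 hz, h⟩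
  rw [← count_roots] at h1
  exact absurd (Multiset.nodup_iff_count_le_one.1 hnd z) (not_le.2 h1)

/-- The product of the derivatives at the roots of a square-free integer polynomial is bounded
below. -/
theorem one_le_leadingCoeff_pow_mul_prod_derivative {p : ℤ[X]} {S : Finset ℂ} (hp : p ≠ 0)
    (hS : (p.map (Int.castRingHom ℂ)).roots = S.val) :
    1 ≤ ‖(p.map (Int.castRingHom ℂ)).leadingCoeff‖ ^ (p.natDegree - 1) *
      ∏ z ∈ S, ‖(p.map (Int.castRingHom ℂ)).derivative.eval z‖ := by
  set f := p.map (Int.castRingHom ℂ) with hf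
  have hf0 : f ≠ 0 := (Polynomial.map_ne_zero_iff (RingHom.injective_int _)).2 hp
  have hdeg : f.natDegree = p.natDegree := natDegree_map_eq_of_injective (RingHom.injective_int _) p
  have hres : resultant f f.derivative f.natDegree (p.natDegree - 1) =
      f.leadingCoeff ^ (p.natDegree - 1) * ∏ z ∈ S, f.derivative.eval z := by
    rw [resultant_eq_prod_eval f f.derivative (p.natDegree - 1)
      (hdeg ▸ natDegree_derivative_le f) (IsAlgClosed.splits f), hS]
    rfl
  -- The same resultant, computed over `ℤ`, is an integer; simple roots make it nonzero, so its
  -- absolute value is at least one.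
  have hint : resultant f f.derivative f.natDegree (p.natDegree - 1) =
      ((resultant p p.derivative f.natDegree (p.natDegree - 1) : ℤ) : ℂ) := by
    rw [hf, derivative_map, resultant_map_map]; rfl
  have hne : resultant f f.derivative f.natDegree (p.natDegree - 1) ≠ 0 := by
    rw [hres]
    refine mul_ne_zero (pow_ne_zero _ (leadingCoeff_ne_zero.2 hf0))
      (Finset.prod_ne_zero_iff.2 fun z hz => ?_)
    exact eval_derivative_ne_zero_of_nodup_roots hf0 (hS ▸ S.nodup) (hS ▸ hz)
  have h1 : 1 ≤ ‖resultant f f.derivative f.natDegree (p.natDegree - 1)‖ := by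
    rw [hint] at hne ⊢
    rw [Complex.norm_intCast]
    exact_mod_cast Int.one_le_abs (by exact_mod_cast hne)
  rwa [hres, norm_mul, norm_pow, norm_prod] at h1

/-- The truncated separations of the roots of a square-free integer polynomial with coefficients
at most `B` have a product that is not too small. -/
theorem exists_separation_prod {p : ℤ[X]} {S : Finset ℂ} {B : ℝ} (hp : 1 ≤ p.natDegree)
    (hS : (p.map (Int.castRingHom ℂ)).roots = S.val)
    (hB : ∀ i, ‖(p.map (Int.castRingHom ℂ)).coeff i‖ ≤ B) :
    ∃ δ : ℂ → ℝ, (∀ z ∈ S, 0 < δ z ∧ δ z ≤ 1 ∧ ∀ y ∈ S, z ≠ y → δ z ≤ ‖z - y‖) ∧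
      1 ≤ (3 * (p.natDegree + 1) ^ 4 * B ^ 3) ^ p.natDegree * ∏ z ∈ S, δ z := by
  have hp0 : p ≠ 0 := by rintro rfl; simp at hp
  have hprod := one_le_leadingCoeff_pow_mul_prod_derivative hp0 hS
  set f := p.map (Int.castRingHom ℂ) with hf
  have hdeg : f.natDegree = p.natDegree := natDegree_map_eq_of_injective (RingHom.injective_int _) p
  have hlc : 1 ≤ ‖f.leadingCoeff‖ := by
    rw [hf, leadingCoeff_map_of_injective (RingHom.injective_int _), eq_intCast,
      Complex.norm_intCast]
    exact_mod_cast Int.one_le_abs (leadingCoeff_ne_zero.2 hp0)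
  have hB1 : 1 ≤ B := hlc.trans (hB _)
  have hcard : S.card = p.natDegree := by
    have := (IsAlgClosed.splits f).natDegree_eq_card_roots
    rw [hS, hdeg] at this
    exact this.symm
  have hex : ∀ z : ℂ, ∃ δ : ℝ, z ∈ S → 0 < δ ∧ δ ≤ 1 ∧ (∀ y ∈ S, z ≠ y → δ ≤ ‖z - y‖) ∧
      ‖f.derivative.eval z‖ ≤
        (f.natDegree + 1) * (f.natDegree ^ 2 * B) * (3 * max 1 ‖z‖ ^ f.natDegree) * δ := by
    intro z
    by_cases hz : z ∈ S
    · obtain ⟨δ, h1, h2, h3, h4⟩ := exists_separation hB (hdeg ▸ hp)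
        (show z ∈ f.roots by rw [hS]; exact hz)
      exact ⟨δ, fun _ => ⟨h1, h2, fun y hy => h3 y (by rw [hS]; exact hy), h4⟩⟩
    · exact ⟨0, fun h => absurd h hz⟩
  choose δ hδ using hex
  refine ⟨δ, fun z hz => ⟨(hδ z hz).1, (hδ z hz).2.1, (hδ z hz).2.2.1⟩, hprod.trans ?_⟩
  rw [hdeg] at hδ
  set d := p.natDegree with hd
  have hδ0 : 0 ≤ ∏ z ∈ S, δ z := Finset.prod_nonneg fun z hz => (hδ z hz).1.le
  -- Landau's inequality, with `√(d + 1)` weakened to `d + 1`; `1 ≤ ‖f.leadingCoeff‖` allows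
  -- dropping the leading coefficient from the Mahler measure.
  have hmahler : ∏ z ∈ S, max 1 ‖z‖ ≤ (d + 1) * B := by
    have h1 := prod_max_one_norm_roots_le_mahlerMeasure_of_one_le_leadingCoeff hlc
    rw [hS] at h1
    refine (show _ ≤ _ from h1).trans ((mahlerMeasure_le_sqrt_natDegree_add_one_mul_supNorm f).trans ?_)
    rw [hdeg]
    refine mul_le_mul ?_ ?_ f.supNorm_nonneg (by positivity)
    · refine Real.sqrt_le_iff.2 ⟨by positivity, ?_⟩
      nlinarith [(Nat.cast_nonneg d : (0 : ℝ) ≤ d)]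
    · obtain ⟨i, hi⟩ := f.exists_eq_supNorm
      rw [hi]; exact hB i
  calc _ ≤ B ^ d * ∏ z ∈ S, ((d + 1) * (d ^ 2 * B) * (3 * max 1 ‖z‖ ^ d) * δ z) := by
        refine mul_le_mul ?_ (Finset.prod_le_prod (fun _ _ => norm_nonneg _)
          fun z hz => (hδ z hz).2.2.2) (Finset.prod_nonneg fun _ _ => norm_nonneg _) (by positivity)
        exact (pow_le_pow_left₀ (norm_nonneg _) (hB _) _).trans
          (pow_le_pow_right₀ hB1 (Nat.sub_le _ _))
    _ = (B * ((d + 1) * (d ^ 2 * B) * 3) * ∏ z ∈ S, max 1 ‖z‖) ^ d * ∏ z ∈ S, δ z := by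
        rw [Finset.prod_mul_distrib, Finset.prod_mul_distrib, Finset.prod_const,
          Finset.prod_mul_distrib, Finset.prod_const, Finset.prod_pow, hcard]
        simp only [mul_pow]
        ring
    _ ≤ (3 * (d + 1) ^ 4 * B ^ 3) ^ d * ∏ z ∈ S, δ z := by
        have hP : 0 ≤ ∏ z ∈ S, max 1 ‖z‖ := Finset.prod_nonneg fun _ _ => by positivity
        refine mul_le_mul_of_nonneg_right (pow_le_pow_left₀ (by positivity) ?_ _) hδ0
        calc _ ≤ B * ((d + 1) * ((d + 1) ^ 2 * B) * 3) * ((d + 1) * B) := by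
              gcongr; linarith
          _ = _ := by ring

/-! ### Charging tree nodes to roots -/

/-- If every non-terminal interval at depth `k` increases the monotone potential `G k` by at least
one, then the size of the subdivision tree is controlled by the total variation of the
potentials. -/
theorem exists_subdivisionTree_size_le {B : ℝ → ℝ → Prop} (n : ℕ) (G : ℕ → ℝ → ℝ) (a w : ℝ)
    (hw : 0 < w) (hmono : ∀ k, Monotone (G k))
    (hnot : ∀ k x, ¬ B x (x + w / 2 ^ k) → 1 ≤ G k (x + w / 2 ^ k) - G k x)
    (hend : ∀ x, B x (x + w / 2 ^ n)) :
    ∃ T : BisectionTree, T.IsSubdivisionTree B a (a + w) ∧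
      (T.size : ℝ) ≤ 1 + 2 * ∑ k ∈ Finset.range n, (G k (a + w) - G k a) := by
  induction n generalizing G a w with
  | zero => exact ⟨.leaf, by simpa [BisectionTree.IsSubdivisionTree] using hend a, by simp [BisectionTree.size]⟩
  | succ n ih =>
    by_cases hB : B a (a + w)
    · refine ⟨.leaf, hB, ?_⟩
      have : 0 ≤ ∑ k ∈ Finset.range (n + 1), (G k (a + w) - G k a) :=
        Finset.sum_nonneg fun k _ => sub_nonneg.2 (hmono k (by linarith))
      simp only [BisectionTree.size]
      push_cast
      linarith
    have hdiv : ∀ k : ℕ, w / 2 / 2 ^ k = w / 2 ^ (k + 1) := fun k => by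
      rw [pow_succ']; field_simp
    have hhalf : ∀ x, ∃ T : BisectionTree, T.IsSubdivisionTree B x (x + w / 2) ∧
        (T.size : ℝ) ≤ 1 + 2 * ∑ k ∈ Finset.range n, (G (k + 1) (x + w / 2) - G (k + 1) x) :=
      fun x => ih (fun k => G (k + 1)) x (w / 2) (by linarith) (fun k => hmono _)
        (fun k x => by rw [hdiv]; exact hnot (k + 1) x) (fun x => by rw [hdiv]; exact hend x)
    obtain ⟨T₁, h₁, s₁⟩ := hhalf a
    obtain ⟨T₂, h₂, s₂⟩ := hhalf (a + w / 2)
    have e : a + w / 2 + w / 2 = a + w := by ring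
    rw [e] at h₂ s₂
    have em : (a + (a + w)) / 2 = a + w / 2 := by ring
    refine ⟨.node T₁ T₂, ⟨hB, by rwa [em], by rwa [em]⟩, ?_⟩
    -- The two halves and the root contribute `1 + 1 + 1` to the bound, an excess of two over the
    -- allowed `1`. The rise of `G 0` by at least one, counted twice, pays for it; the deeper
    -- potentials telescope at the midpoint.
    have h0 := hnot 0 a (by simpa using hB)
    rw [pow_zero, div_one] at h0
    rw [Finset.sum_range_succ']
    have hs : ∑ k ∈ Finset.range n, (G (k + 1) (a + w) - G (k + 1) a) =
        ∑ k ∈ Finset.range n, (G (k + 1) (a + w / 2) - G (k + 1) a) +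
        ∑ k ∈ Finset.range n, (G (k + 1) (a + w) - G (k + 1) (a + w / 2)) := by
      rw [← Finset.sum_add_distrib]
      exact Finset.sum_congr rfl fun k _ => by ring
    rw [hs]
    simp only [BisectionTree.size]
    push_cast
    linarith

theorem card_filter_two_pow_lt_le (n : ℕ) {x : ℝ} (hx : 1 ≤ x) :
    (((Finset.range n).filter fun k => (2 : ℝ) ^ k < x).card : ℝ) ≤
      1 + Real.log x / Real.log 2 := by
  have h2 : 0 < Real.log 2 := Real.log_pos one_lt_two
  have h0 : 0 ≤ Real.log x / Real.log 2 := div_nonneg (Real.log_nonneg hx) h2.le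
  have hsub : ((Finset.range n).filter fun k => (2 : ℝ) ^ k < x) ⊆
      Finset.range (⌊Real.log x / Real.log 2⌋₊ + 1) := by
    intro k hk
    have hk' := (Finset.mem_filter.1 hk).2
    rw [Finset.mem_range, Nat.lt_succ_iff, Nat.le_floor_iff h0, le_div_iff₀ h2, ← Real.log_pow]
    exact Real.log_le_log (by positivity) hk'.le
  calc _ ≤ ((⌊Real.log x / Real.log 2⌋₊ + 1 : ℕ) : ℝ) := by
        exact_mod_cast (Finset.card_le_card hsub).trans (Finset.card_range _).le
    _ ≤ _ := by
        have := Nat.floor_le h0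
        push_cast
        linarith

/-- The potential of a point set with separations `δ` at resolution `u`. -/
noncomputable def rootPotential (S : Finset ℂ) (δ : ℂ → ℝ) (u x : ℝ) : ℝ :=
  ∑ z ∈ S, if δ z < 4 * u then max (z.re - 2 * u) (min (z.re + 3 * u) x) / u else 0

theorem rootPotential_monotone (S : Finset ℂ) (δ : ℂ → ℝ) {u : ℝ} (hu : 0 < u) :
    Monotone (rootPotential S δ u) := by
  intro x y hxy
  refine Finset.sum_le_sum fun z _ => ?_
  split_ifs
  · gcongr
  · exact le_rfl

/-- The summand of `z` is a ramp of slope `1 / u` on `[z.re - 2 * u, z.re + 3 * u]`. This range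
contains `[x, x + u]` whenever `z` is within `2 * u` of `x`, so that summand alone rises by one. -/
theorem one_le_rootPotential_sub {S : Finset ℂ} {δ : ℂ → ℝ} {u x : ℝ} (hu : 0 < u) {z : ℂ}
    (hz : z ∈ S) (hδ : δ z < 4 * u) (hzx : ‖z - x‖ < 2 * u) :
    1 ≤ rootPotential S δ u (x + u) - rootPotential S δ u x := by
  rw [rootPotential, rootPotential, ← Finset.sum_sub_distrib]
  have habs := abs_lt.1 ((Complex.abs_re_le_norm (z - x)).trans_lt hzx)
  simp only [Complex.sub_re, Complex.ofReal_re] at habs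
  refine le_trans (le_of_eq ?_) (Finset.single_le_sum (fun y _ => ?_) hz)
  · rw [if_pos hδ, if_pos hδ, min_eq_right (by linarith), min_eq_right (by linarith),
      max_eq_right (by linarith), max_eq_right (by linarith)]
    field_simp
    ring
  · rw [sub_nonneg]
    split_ifs
    · gcongr; linarith
    · exact le_rfl

/-- Each ramp has length `5 * u` and slope `1 / u`, hence total height five. -/
theorem rootPotential_sub_le (S : Finset ℂ) (δ : ℂ → ℝ) {u : ℝ} (hu : 0 < u) (x y : ℝ) :
    rootPotential S δ u y - rootPotential S δ u x ≤ ∑ z ∈ S, if δ z < 4 * u then 5 else 0 := by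
  rw [rootPotential, rootPotential, ← Finset.sum_sub_distrib]
  refine Finset.sum_le_sum fun z _ => ?_
  split_ifs
  · rw [← sub_div, div_le_iff₀ hu]
    have h1 : max (z.re - 2 * u) (min (z.re + 3 * u) y) ≤ z.re + 3 * u :=
      max_le (by linarith) (min_le_left _ _)
    have h2 := le_max_left (z.re - 2 * u) (min (z.re + 3 * u) x)
    linarith
  · simp

theorem sum_rootPotential_sub_le (S : Finset ℂ) (δ : ℂ → ℝ) {w : ℝ} (hw : 1 ≤ w)
    (hδ : ∀ z ∈ S, 0 < δ z ∧ δ z ≤ 1) (n : ℕ) (x y : ℝ) :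
    ∑ k ∈ Finset.range n, (rootPotential S δ (w / 2 ^ k) y - rootPotential S δ (w / 2 ^ k) x) ≤
      5 * (S.card + (S.card * Real.log (4 * w) - Real.log (∏ z ∈ S, δ z)) / Real.log 2) := by
  calc _ ≤ ∑ k ∈ Finset.range n, ∑ z ∈ S, if δ z < 4 * (w / 2 ^ k) then (5 : ℝ) else 0 :=
        Finset.sum_le_sum fun k _ => rootPotential_sub_le S δ (by positivity) x y
    _ = ∑ z ∈ S, 5 * (((Finset.range n).filter fun k => (2 : ℝ) ^ k < 4 * w / δ z).card : ℝ) := by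
        rw [Finset.sum_comm]
        refine Finset.sum_congr rfl fun z hz => ?_
        have := (hδ z hz).1
        rw [Finset.sum_ite, Finset.sum_const_zero, add_zero, Finset.sum_const, nsmul_eq_mul,
          mul_comm]
        congr 3
        refine Finset.filter_congr fun k _ => ?_
        rw [lt_div_iff₀ this, ← mul_div_assoc, lt_div_iff₀ (by positivity), mul_comm]
    _ ≤ ∑ z ∈ S, 5 * (1 + (Real.log (4 * w) - Real.log (δ z)) / Real.log 2) := by
        refine Finset.sum_le_sum fun z hz => ?_
        obtain ⟨h0, h1⟩ := hδ z hz
        rw [← Real.log_div (by positivity) h0.ne']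
        gcongr
        exact card_filter_two_pow_lt_le n ((one_le_div h0).2 (by linarith))
    _ = _ := by
        rw [Real.log_prod fun z hz => (hδ z hz).1.ne', ← Finset.mul_sum, Finset.sum_add_distrib,
          ← Finset.sum_div, Finset.sum_sub_distrib]
        simp

/-! ### The main theorem -/

theorem squarefree_map_complex_roots_nodup {p : ℤ[X]}
    (h : Squarefree (p.map (Int.castRingHom ℚ))) :
    (p.map (Int.castRingHom ℂ)).roots.Nodup := by
  have hsep : (p.map (Int.castRingHom ℚ)).Separable := PerfectField.separable_iff_squarefree.2 h
  have hmap : p.map (Int.castRingHom ℂ) =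
      (p.map (Int.castRingHom ℚ)).map (algebraMap ℚ ℂ) := by
    rw [map_map]; congr 1
  rw [hmap]
  exact nodup_roots hsep.map

theorem mainTheorem4 :
    ∃ C : ℝ, 0 < C ∧
      ∀ (d L : ℕ) (p : Polynomial ℤ),
        1 ≤ d →
        p.natDegree = d →
        Squarefree (p.map (Int.castRingHom ℚ)) →
        p.supNorm < (2 : ℝ) ^ L →
        ∃ T : BisectionTree,
          T.IsSubdivisionTree (DescartesPredicate p) (-(2 : ℝ) ^ L) ((2 : ℝ) ^ L) ∧
          (T.size : ℝ) ≤ C * ((d : ℝ) * ((L : ℝ) + Real.log (d : ℝ))) := by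
  -- The final estimate is `1 + 10 * (d + d * (4 * L + 11 + 8 * log d))`. With `1 ≤ d ≤ d * L` this
  -- is at most `161 * d * L + 80 * d * log d`.
  refine ⟨200, by norm_num, ?_⟩
  rintro d L p hd rfl hsf hL
  have hp0 : p ≠ 0 := by rintro rfl; simp at hd
  have hnd := squarefree_map_complex_roots_nodup hsf
  set S : Finset ℂ := ⟨(p.map (Int.castRingHom ℂ)).roots, hnd⟩ with hSdef
  have hS : (p.map (Int.castRingHom ℂ)).roots = S.val := rfl
  have hcard : S.card = p.natDegree := by
    have := (IsAlgClosed.splits (p.map (Int.castRingHom ℂ))).natDegree_eq_card_roots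
    rw [hS, natDegree_map_eq_of_injective (RingHom.injective_int _)] at this
    exact this.symm
  have hcoeff : ∀ i, ‖(p.map (Int.castRingHom ℂ)).coeff i‖ ≤ 2 ^ L := fun i => by
    rw [coeff_map, eq_intCast, Complex.norm_intCast]
    exact (p.le_supNorm i).trans hL.le
  -- For `L = 0` the integer leading coefficient would vanish. This bound lets `d * L` absorb the
  -- terms linear in `d`, which matters when `log d = 0`.
  have hL1 : 1 ≤ L := by
    by_contra! h0
    obtain rfl : L = 0 := by omega
    rw [pow_zero] at hL
    have h1 : (1 : ℝ) ≤ ‖p.leadingCoeff‖ := by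
      rw [Int.norm_eq_abs]
      exact_mod_cast Int.one_le_abs (leadingCoeff_ne_zero.2 hp0)
    exact absurd (h1.trans (p.le_supNorm _)) (not_le.2 hL)
  obtain ⟨δ, hδ, hprod⟩ := exists_separation_prod hd hS hcoeff
  set w : ℝ := 2 ^ (L + 1) with hw
  have hw1 : 1 ≤ w := one_le_pow₀ one_le_two
  have hpos : ∀ k : ℕ, 0 < w / 2 ^ k := fun k => by positivity
  have hnear : ∀ (u x : ℝ), 0 < u → ¬ DescartesPredicate p x (x + u) →
      ∃ z ∈ S, δ z < 4 * u ∧ ‖z - x‖ < 2 * u := by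
    intro u x hu h
    obtain ⟨z, z', hz, hz', hne, h1, h2⟩ :=
      exists_two_roots_of_not_descartesPredicate hnd hp0 hu h
    refine ⟨z, hz, ((hδ z hz).2.2 z' hz' hne).trans_lt ?_, h1⟩
    calc ‖z - z'‖ ≤ ‖z - x‖ + ‖x - z'‖ := norm_sub_le_norm_sub_add_norm_sub _ _ _
      _ < 4 * u := by rw [norm_sub_rev (x : ℂ) z']; linarith
  have hSne : S.Nonempty := Finset.card_pos.1 (by omega)
  obtain ⟨z₀, hz₀, hmin⟩ := S.exists_min_image δ hSne
  -- At depth `n` four interval widths are below the smallest separation, so every interval of that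
  -- width is terminal.
  obtain ⟨n, hn⟩ := pow_unbounded_of_one_lt (4 * w / δ z₀) (one_lt_two (α := ℝ))
  have hend : ∀ x, DescartesPredicate p x (x + w / 2 ^ n) := by
    intro x
    by_contra h
    obtain ⟨z, hz, hzδ, -⟩ := hnear _ x (hpos n) h
    have h1 := (hmin z hz).trans_lt hzδ
    rw [div_lt_iff₀ (hδ z₀ hz₀).1] at hn
    rw [← mul_div_assoc, lt_div_iff₀ (by positivity)] at h1
    linarith
  obtain ⟨T, hT, hsize⟩ := exists_subdivisionTree_size_le n
    (fun k => rootPotential S δ (w / 2 ^ k)) (-2 ^ L) w (by linarith)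
    (fun k => rootPotential_monotone S δ (hpos k))
    (fun k x h => by
      obtain ⟨z, hz, h1, h2⟩ := hnear _ x (hpos k) h
      exact one_le_rootPotential_sub (hpos k) hz h1 h2) hend
  have hend' : -(2 : ℝ) ^ L + w = 2 ^ L := by rw [hw]; ring
  refine ⟨T, by rwa [hend'] at hT, hsize.trans ?_⟩
  have hsum := sum_rootPotential_sub_le S δ hw1 (fun z hz => ⟨(hδ z hz).1, (hδ z hz).2.1⟩) n
    (-2 ^ L) (-2 ^ L + w)
  rw [hcard] at hsum
  set d := p.natDegree with hdd
  have hd1 : (1 : ℝ) ≤ d := by exact_mod_cast hd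
  have hL1' : (1 : ℝ) ≤ L := by exact_mod_cast hL1
  have hδpos : 0 < ∏ z ∈ S, δ z := Finset.prod_pos fun z hz => (hδ z hz).1
  have hl2 : 0 < Real.log 2 := Real.log_pos one_lt_two
  have hl2' : 1 / 2 ≤ Real.log 2 := by have := Real.log_two_gt_d9; linarith
  have hl3 : Real.log 3 ≤ 2 := by
    have := Real.log_le_sub_one_of_pos (show (0 : ℝ) < 3 by norm_num); linarith
  have hld : 0 ≤ Real.log d := Real.log_nonneg hd1
  have hld1 : Real.log (d + 1) ≤ Real.log 2 + Real.log d := by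
    rw [← Real.log_mul (by norm_num) (by positivity)]
    exact Real.log_le_log (by positivity) (by linarith)
  have hlw : Real.log (4 * w) = (L + 3) * Real.log 2 := by
    rw [hw, show (4 : ℝ) * 2 ^ (L + 1) = 2 ^ (L + 3) by ring, Real.log_pow]; push_cast; ring
  have hlprod : -Real.log (∏ z ∈ S, δ z) ≤
      d * (Real.log 3 + 4 * Real.log (d + 1) + 3 * (L * Real.log 2)) := by
    have h := Real.log_nonneg hprod
    rw [Real.log_mul (by positivity) hδpos.ne', Real.log_pow, Real.log_mul (by positivity)
      (by positivity), Real.log_mul (by positivity) (by positivity), Real.log_pow, Real.log_pow,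
      Real.log_pow] at h
    push_cast at h
    linarith
  have hquot : (d * Real.log (4 * w) - Real.log (∏ z ∈ S, δ z)) / Real.log 2 ≤
      d * (4 * L + 11 + 8 * Real.log d) := by
    rw [div_le_iff₀ hl2, hlw]
    -- From `log (d + 1) ≤ log 2 + log d`, using `log 3 ≤ 2 ≤ 4 * log 2` and `1 ≤ 2 * log 2`.
    have h1 : Real.log 3 + 4 * Real.log (d + 1) ≤ (8 + 8 * Real.log d) * Real.log 2 := by
      nlinarith
    have h2 := mul_le_mul_of_nonneg_left h1 (zero_le_one.trans hd1)
    linarith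
  have hdL : (d : ℝ) ≤ d * L := le_mul_of_one_le_right (by positivity) hL1'
  have hdl : 0 ≤ (d : ℝ) * Real.log d := by positivity
  nlinarith
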